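/- Let $H^1(\mathbb R)$ be the Sobolev space of real-valued functions $\psi\in L^2(\mathbb R)$ whose weak derivative $\psi'$ belongs to $L^2(\mathbb R)$, and let $$X=\Bigl\{\psi\in H^1(\mathbb R)\;:\;\int_{\mathbb R}\bigl(|\psi'(s)|^2+s^2|\psi(s)|^2\bigr)\,ds<\infty\Bigr\},\qquad \Sigma_1=\Bigl\{\psi\in X\;:\;\int_{\mathbb R}|\psi(s)|^2\,ds=1\Bigr\}.$$ Let $C_\omega\in\mathbb R$ be a constant, let $\lambda>0$, and for $\psi\in X$ put $$E_\lambda(\psi)=\int_{\mathbb R}|\psi'(s)|^2\,ds+\int_{\mathbb R}s^2|\psi(s)|^2\,ds+C_\omega\int_{\mathbb R}\sqrt{1+2\lambda|\psi(s)|^2}\,|\psi(s)|^2\,ds .$$ Then the three integrals are finite for every $\psi\in X$, so that $E_\lambda:X\to\mathbb R$ is well defined, and there exists $\varphi_{\min}\in\Sigma_1$ such that $$E_\lambda(\varphi_{\min})=\min\{E_\lambda(\psi)\;:\;\psi\in\Sigma_1\}.$$ -/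

import Mathlib

open MeasureTheory
open scoped ContDiff

noncomputable section

namespace GroundState

/-- The real Lebesgue space `L²(ℝ)`. -/
abbrev L2 : Type := Lp ℝ 2 (volume : Measure ℝ)

/-- `g` is the weak (distributional) derivative of `ψ` on `ℝ`:
`∫ ψ φ' = -∫ g φ` for every test function `φ ∈ C_c^∞(ℝ)`. -/
def IsWeakDeriv (ψ g : L2) : Prop :=
  ∀ φ : ℝ → ℝ, ContDiff ℝ ∞ φ → HasCompactSupport φ →
    ∫ s, ψ s * deriv φ s = -∫ s, g s * φ s

/-- The weak derivative in `L²(ℝ)` is unique. -/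
theorem IsWeakDeriv.unique {ψ g h : L2} (hg : IsWeakDeriv ψ g) (hh : IsWeakDeriv ψ h) :
    g = h := by
  have hloc : ∀ f : L2, LocallyIntegrable f volume := fun f =>
    (Lp.memLp f).locallyIntegrable (by norm_num)
  refine Lp.ext (ae_eq_of_integral_contDiff_smul_eq (hloc g) (hloc h) fun φ hφ hc => ?_)
  have h1 := hg φ hφ hc
  have h2 := hh φ hφ hc
  simp only [smul_eq_mul]
  simp_rw [mul_comm (φ _)]
  linarith

/-- The Sobolev space `H¹(ℝ)` of real functions in `L²(ℝ)` with weak derivative in `L²(ℝ)`. -/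
def H1 : Set L2 := {ψ | ∃ g : L2, IsWeakDeriv ψ g}

open Classical in
/-- The weak derivative `ψ'` of `ψ ∈ H¹(ℝ)` (by convention `0` if `ψ ∉ H¹(ℝ)`). -/
def weakDeriv (ψ : L2) : L2 :=
  if h : ∃ g : L2, IsWeakDeriv ψ g then h.choose else 0

theorem isWeakDeriv_weakDeriv {ψ : L2} (h : ψ ∈ H1) : IsWeakDeriv ψ (weakDeriv ψ) := by
  have h' : ∃ g : L2, IsWeakDeriv ψ g := h
  rw [weakDeriv, dif_pos h']
  exact h'.choose_spec

theorem IsWeakDeriv.weakDeriv_eq {ψ g : L2} (h : IsWeakDeriv ψ g) : weakDeriv ψ = g :=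
  (isWeakDeriv_weakDeriv ⟨g, h⟩).unique h

/-- The weighted space `X = {ψ ∈ H¹(ℝ) : ∫ (|ψ'|² + s² |ψ|²) ds < ∞}`. -/
def X : Set L2 :=
  {ψ | ψ ∈ H1 ∧ Integrable (fun s : ℝ => weakDeriv ψ s ^ 2 + s ^ 2 * ψ s ^ 2)}

/-- The charge `Q(ψ) = ∫ |ψ|² ds`. -/
def charge (ψ : L2) : ℝ := ∫ s, ψ s ^ 2

/-- The density of the nonlinear part of the energy, `G_lam(ρ) = √(1 + 2 lam ρ²) ρ²`. -/
def G (lam ρ : ℝ) : ℝ := Real.sqrt (1 + 2 * lam * ρ ^ 2) * ρ ^ 2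

/-- The energy
`E_lam(ψ) = ∫ |ψ'|² ds + ∫ s² |ψ|² ds + C ∫ √(1 + 2 lam |ψ|²) |ψ|² ds`, where `C` stands for
the constant `C_ω`. -/
def energy (C lam : ℝ) (ψ : L2) : ℝ :=
  (∫ s, weakDeriv ψ s ^ 2) + (∫ s, s ^ 2 * ψ s ^ 2) + C * ∫ s, G lam (ψ s)

/-- The constraint set `Σ₁ = {ψ ∈ X : Q(ψ) = 1}`. -/
def Sigma1 : Set L2 := {ψ | ψ ∈ X ∧ charge ψ = 1}

end GroundState

end

namespace GroundState

open Filter Topology Set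

/-! Direct method. An `H¹` function is a primitive of its weak derivative, so its sup norm is
bounded by its charge plus an arbitrarily small multiple of the kinetic energy plus a constant
(`IsWeakDeriv.ae_abs_le`). On `Sigma1` the nonlinear term grows at most linearly in the sup norm, so
half the kinetic energy absorbs it for either sign of `C` (`exists_le_energy`), and minimizing
sequences have bounded kinetic and potential energy.

Weak `L²` compactness of the derivatives makes the primitives converge pointwise along a
subsequence. The weight `s²` prevents mass from escaping to infinity, so the charge and the
nonlinear term converge (`tendsto_integral_comp_of_weight`). The kinetic term is weakly lower
semicontinuous and the potential term obeys Fatou's lemma, so the limit is a minimizer. -/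

/-! ### Weak derivatives and primitives. -/

theorem exists_primitive_of_integral_eq_zero {χ : ℝ → ℝ} (hχ : ContDiff ℝ ∞ χ)
    (hc : HasCompactSupport χ) (h0 : ∫ x, χ x = 0) :
    ∃ Φ : ℝ → ℝ, ContDiff ℝ ∞ Φ ∧ HasCompactSupport Φ ∧ deriv Φ = χ := by
  obtain ⟨R, hR⟩ := hc.isCompact.isBounded.subset_closedBall 0
  have hz : ∀ x, R < |x| → χ x = 0 := fun x hx => by
    by_contra hne
    have := hR (subset_tsupport _ hne)
    rw [mem_closedBall_zero_iff, Real.norm_eq_abs] at this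
    linarith
  have hd : ∀ x, HasDerivAt (fun x => ∫ t in (-(|R| + 1))..x, χ t) (χ x) x := fun x =>
    hχ.continuous.integral_hasStrictDerivAt _ x |>.hasDerivAt
  refine ⟨fun x => ∫ t in (-(|R| + 1))..x, χ t, ?_, ?_, funext fun x => (hd x).deriv⟩
  · rw [contDiff_infty_iff_deriv]
    refine ⟨fun x => (hd x).differentiableAt, ?_⟩
    rwa [show deriv (fun x => ∫ t in (-(|R| + 1))..x, χ t) = χ from funext fun x => (hd x).deriv]
  · refine HasCompactSupport.of_support_subset_isCompact
      (isCompact_Icc (a := -(|R| + 1)) (b := |R| + 1)) fun x hx => ?_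
    by_contra hx'
    apply hx
    rw [mem_Icc, not_and_or, not_le, not_le] at hx'
    have hRR := le_abs_self R
    have hR0 := abs_nonneg R
    rcases hx' with hx' | hx'
    · refine (intervalIntegral.integral_congr (g := fun _ => 0) fun t ht => ?_).trans (by simp)
      rw [uIcc_of_ge hx'.le] at ht
      refine hz t ?_
      rw [abs_of_nonpos (by linarith [ht.2])]
      linarith [ht.2]
    · change ∫ t in (-(|R| + 1))..x, χ t = 0
      rw [intervalIntegral.integral_eq_integral_of_support_subset, h0]
      intro t ht
      have : |t| ≤ R := not_lt.1 fun h => ht (hz t h)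
      rw [abs_le] at this
      exact ⟨by linarith, by linarith⟩

/-- Du Bois-Reymond lemma. -/
theorem ae_eq_const_of_integral_mul_deriv_eq_zero {h : ℝ → ℝ} (hh : LocallyIntegrable h)
    (H : ∀ φ : ℝ → ℝ, ContDiff ℝ ∞ φ → HasCompactSupport φ → ∫ s, h s * deriv φ s = 0) :
    ∃ c, ∀ᵐ x, h x = c := by
  let η : ContDiffBump (0 : ℝ) := ⟨1, 2, one_pos, one_lt_two⟩
  set e := η.normed (volume : Measure ℝ) with he
  have hec : HasCompactSupport e := η.hasCompactSupport_normed
  have hes : ContDiff ℝ ∞ e := η.contDiff_normed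
  have hint : ∀ φ : ℝ → ℝ, Continuous φ → HasCompactSupport φ →
      Integrable (fun s => φ s * h s) := fun φ hφ hc =>
    hh.integrable_smul_left_of_hasCompactSupport hφ hc
  refine ⟨∫ s, e s * h s, ae_eq_of_integral_contDiff_smul_eq hh
    (locallyIntegrable_const _) fun φ hφ hc => ?_⟩
  have hφi : Integrable φ := hφ.continuous.integrable_of_hasCompactSupport hc
  have hei : Integrable e := η.integrable_normed
  -- Subtracting `(∫ φ) e` gives mean zero, hence the derivative of a test function, to which `H`
  -- applies.
  obtain ⟨Φ, hΦ, hΦc, hΦd⟩ := exists_primitive_of_integral_eq_zero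
    (χ := fun x => φ x - (∫ t, φ t) * e x) (hφ.sub (contDiff_const.mul hes))
    (hc.sub hec.mul_left) (by
      rw [integral_sub hφi (hei.const_mul _), integral_const_mul, he, η.integral_normed]
      simp)
  have key := H Φ hΦ hΦc
  rw [hΦd] at key
  have : ∀ s, h s * (φ s - (∫ t, φ t) * e s) = φ s * h s - (∫ t, φ t) * (e s * h s) :=
    fun s => by ring
  simp_rw [this] at key
  rw [integral_sub (hint _ hφ.continuous hc) ((hint _ hes.continuous hec).const_mul _),
    integral_const_mul] at key
  simp only [smul_eq_mul]
  rw [integral_mul_const]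
  linarith

/-- The primitive is absolutely continuous, so it can be integrated by parts on an interval around
the support of `φ`. -/
theorem integral_primitive_mul_deriv {g : ℝ → ℝ} (hg : LocallyIntegrable g) {φ : ℝ → ℝ}
    (hφ : ContDiff ℝ ∞ φ) (hc : HasCompactSupport φ) :
    ∫ x, (∫ t in (0 : ℝ)..x, g t) * deriv φ x = -∫ x, g x * φ x := by
  obtain ⟨R, hR⟩ := hc.isCompact.isBounded.subset_closedBall 0
  -- The margin `1` puts both endpoints off the support, which kills the boundary terms.
  have hsub : tsupport φ ⊆ Ioc (-(|R| + 1)) (|R| + 1) := fun x hx => by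
    have := hR hx
    rw [mem_closedBall_zero_iff, Real.norm_eq_abs, abs_le] at this
    have hRR := le_abs_self R
    exact ⟨by linarith, by linarith⟩
  have hz : ∀ x, x ∉ tsupport φ → φ x = 0 := fun x hx => image_eq_zero_of_notMem_tsupport hx
  have hR0 := abs_nonneg R
  have hR1 : |R| + 1 ∉ tsupport φ := fun h => by
    have h1 := hR h
    rw [mem_closedBall_zero_iff, Real.norm_eq_abs, abs_le] at h1
    linarith [le_abs_self R]
  have hgi : IntervalIntegrable g volume (-(|R| + 1)) (|R| + 1) :=
    (hg.integrableOn_isCompact isCompact_uIcc).intervalIntegrable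
  have h0 : (0 : ℝ) ∈ uIcc (-(|R| + 1)) (|R| + 1) := by
    rw [uIcc_of_le (by linarith)]
    exact ⟨by linarith, by linarith⟩
  have hw := hgi.absolutelyContinuousOnInterval_intervalIntegral h0
  have hφa : AbsolutelyContinuousOnInterval φ (-(|R| + 1)) (|R| + 1) :=
    ContDiffOn.absolutelyContinuousOnInterval (hφ.of_le (by simp)).contDiffOn
  have key := hw.integral_mul_deriv_eq_deriv_mul hφa
  rw [hz _ hR1, hz _ fun h => lt_irrefl _ (hsub h).1] at key
  rw [intervalIntegral.integral_eq_integral_of_support_subset] at key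
  · rw [key]
    rw [← intervalIntegral.integral_eq_integral_of_support_subset (f := fun x => g x * φ x)
      (a := -(|R| + 1)) (b := |R| + 1)]
    · simp only [mul_zero, sub_self, zero_sub, neg_inj]
      apply intervalIntegral.integral_congr_ae
      filter_upwards [hgi.ae_hasDerivAt_integral] with x hx hx'
      rw [(hx (uIoc_subset_uIcc hx') 0 h0).deriv]
    · exact (Function.support_mul_subset_right _ _).trans ((subset_tsupport _).trans hsub)
  · exact (Function.support_mul_subset_right _ _).trans
      ((support_deriv_subset (f := φ)).trans hsub)

theorem L2.locallyIntegrable (f : L2) : LocallyIntegrable f volume :=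
  (Lp.memLp f).locallyIntegrable (by norm_num)

theorem L2.intervalIntegrable (f : L2) (a b : ℝ) : IntervalIntegrable f volume a b :=
  (f.locallyIntegrable.integrableOn_isCompact isCompact_uIcc).intervalIntegrable

theorem L2.continuous_primitive (f : L2) : Continuous fun x => ∫ t in (0 : ℝ)..x, f t :=
  intervalIntegral.continuous_primitive (fun a b => f.intervalIntegrable a b) 0

/-- An `H¹` function is a.e. equal to a primitive of its weak derivative. -/
theorem IsWeakDeriv.exists_ae_eq_primitive {ψ g : L2} (h : IsWeakDeriv ψ g) :
    ∃ a : ℝ, ∀ᵐ x, ψ x = a + ∫ t in (0 : ℝ)..x, g t := by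
  have hw : LocallyIntegrable fun x => ∫ t in (0 : ℝ)..x, g t :=
    g.continuous_primitive.locallyIntegrable
  obtain ⟨a, ha⟩ := ae_eq_const_of_integral_mul_deriv_eq_zero
    (h := fun x => ψ x - ∫ t in (0 : ℝ)..x, g t) (ψ.locallyIntegrable.sub hw) fun φ hφ hc => by
      have hd : Continuous (deriv φ) := hφ.continuous_deriv (by simp)
      have h1 : Integrable fun s => ψ s * deriv φ s :=
        ψ.locallyIntegrable.integrable_smul_right_of_hasCompactSupport hd hc.deriv
      have h2 : Integrable fun s => (∫ t in (0 : ℝ)..s, g t) * deriv φ s :=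
        hw.integrable_smul_right_of_hasCompactSupport hd hc.deriv
      simp_rw [sub_mul]
      rw [integral_sub h1 h2, h φ hφ hc, integral_primitive_mul_deriv g.locallyIntegrable hφ hc,
        sub_self]
  exact ⟨a, ha.mono fun x hx => by linarith⟩

/-! ### Sup-norm bound. -/

theorem L2.integrable_sq (f : L2) : Integrable fun s => f s ^ 2 :=
  (Lp.memLp f).integrable_sq

theorem L2.norm_sq_eq (f : L2) : ‖f‖ ^ 2 = ∫ s, f s ^ 2 := by
  rw [← real_inner_self_eq_norm_sq, L2.inner_def]
  simp [pow_two]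

/-- Young's inequality under the integral; `ε` stays free so that coercivity can make the
derivative's share small. -/
theorem abs_setIntegral_le (g : L2) {s : Set ℝ} (hv : volume.real s ≤ 1)
    (hv' : volume s ≠ ⊤) {ε : ℝ} (hε : 0 < ε) :
    |∫ t in s, g t| ≤ (ε⁻¹ + ε * ∫ t, g t ^ 2) / 2 := by
  have hg2 := g.integrable_sq
  have hc : IntegrableOn (fun _ : ℝ => ε⁻¹ / 2) s := integrableOn_const hv'
  have hg2s : IntegrableOn (fun t => ε / 2 * g t ^ 2) s := (hg2.const_mul _).integrableOn
  calc |∫ t in s, g t| ≤ ∫ t in s, (ε⁻¹ / 2 + ε / 2 * g t ^ 2) := by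
        refine norm_integral_le_of_norm_le (μ := volume.restrict s) (f := fun t => g t)
          (hc.add hg2s) (.of_forall fun t => ?_)
        rw [Real.norm_eq_abs, ← sq_abs (g t)]
        have h := mul_nonneg (inv_pos.2 hε).le (sq_nonneg (1 - ε * |g t|))
        have : ε⁻¹ * (1 - ε * |g t|) ^ 2 = ε⁻¹ - 2 * |g t| + ε * |g t| ^ 2 := by
          field_simp; ring
        linarith
    _ = volume.real s * (ε⁻¹ / 2) + ε / 2 * ∫ t in s, g t ^ 2 := by
        rw [integral_add hc hg2s, integral_const_mul]
        simp
    _ ≤ 1 * (ε⁻¹ / 2) + ε / 2 * ∫ t, g t ^ 2 := by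
        gcongr ?_ + _ * ?_
        · gcongr
        · exact setIntegral_le_integral hg2 (.of_forall fun t => sq_nonneg _)
    _ = _ := by ring

/-- Pointwise bound for a function with primitive representation (Sobolev embedding on `ℝ`). -/
theorem abs_add_primitive_le {ψ g : L2} {a : ℝ} (ha : ∀ᵐ x, ψ x = a + ∫ t in (0 : ℝ)..x, g t)
    {ε : ℝ} (hε : 0 < ε) (x : ℝ) :
    |a + ∫ t in (0 : ℝ)..x, g t| ≤ √(charge ψ) + (ε⁻¹ + ε * ∫ t, g t ^ 2) / 2 := by
  set u : ℝ → ℝ := fun x => a + ∫ t in (0 : ℝ)..x, g t with hu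
  have hu2 : Integrable fun x => u x ^ 2 :=
    ψ.integrable_sq.congr (ha.mono fun x hx => by simp only [hx, hu])
  have hvol : volume (Ioc x (x + 1)) = 1 := by simp
  -- Some `y` within distance `1` of `x` has `u y ^ 2` at most the local mean, hence at most the
  -- charge.
  obtain ⟨y, hy, hyu⟩ := exists_le_setAverage (μ := volume) (s := Ioc x (x + 1))
    (by simp) (by simp) hu2.integrableOn
  have hyQ : u y ^ 2 ≤ charge ψ := by
    refine hyu.trans ?_
    rw [setAverage_eq, measureReal_def, hvol]
    simp only [ENNReal.toReal_one, inv_one, one_smul]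
    refine (setIntegral_le_integral hu2 (.of_forall fun t => sq_nonneg _)).trans_eq ?_
    exact integral_congr_ae (ha.mono fun x hx => by simp only [hx, hu])
  have hy' : |u y| ≤ √(charge ψ) := Real.abs_le_sqrt hyQ
  have hdiff : u x = u y - ∫ t in x..y, g t := by
    have := intervalIntegral.integral_add_adjacent_intervals (g.intervalIntegrable 0 x)
      (g.intervalIntegrable x y)
    simp only [hu]
    linarith
  have hb : |∫ t in x..y, g t| ≤ (ε⁻¹ + ε * ∫ t, g t ^ 2) / 2 := by
    rw [intervalIntegral.integral_of_le hy.1.le]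
    refine abs_setIntegral_le g ?_ (by simp) hε
    rw [Real.volume_real_Ioc_of_le hy.1.le]
    linarith [hy.2]
  change |u x| ≤ _
  rw [hdiff]
  exact (abs_sub _ _).trans (add_le_add hy' hb)

theorem IsWeakDeriv.ae_abs_le {ψ g : L2} (h : IsWeakDeriv ψ g) {ε : ℝ} (hε : 0 < ε) :
    ∀ᵐ x, |ψ x| ≤ √(charge ψ) + (ε⁻¹ + ε * ∫ t, g t ^ 2) / 2 := by
  obtain ⟨a, ha⟩ := h.exists_ae_eq_primitive
  filter_upwards [ha] with x hx
  rw [hx]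
  exact abs_add_primitive_le ha hε x

/-! ### The nonlinear density and coercivity. -/

theorem continuous_G (lam : ℝ) : Continuous (G lam) := by
  unfold G
  fun_prop

theorem G_nonneg (lam ρ : ℝ) : 0 ≤ G lam ρ := by
  unfold G
  positivity

/-- The square root is at most `1 + (1 + lam) |ρ|`, because `(1 + lam)² ≥ 2 lam`. -/
theorem G_le {lam : ℝ} (hlam : 0 < lam) {ρ K : ℝ} (hK : |ρ| ≤ K) :
    G lam ρ ≤ (1 + (1 + lam) * K) * ρ ^ 2 := by
  unfold G
  gcongr
  refine Real.sqrt_le_iff.2 ⟨by nlinarith [abs_nonneg ρ], ?_⟩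
  have h1 : (1 + (1 + lam) * |ρ|) ^ 2 ≤ (1 + (1 + lam) * K) ^ 2 := by gcongr
  rw [← sq_abs ρ]
  nlinarith [abs_nonneg ρ, mul_nonneg hlam.le (abs_nonneg ρ), sq_nonneg (lam * |ρ|),
    sq_nonneg |ρ|]

theorem integrable_weight_of_mem_X {ψ : L2} (h : ψ ∈ X) :
    Integrable fun s : ℝ => s ^ 2 * ψ s ^ 2 :=
  (h.2.sub (weakDeriv ψ).integrable_sq).congr (.of_forall fun s => by simp)

theorem integrable_comp_of_ae_abs_le {ψ : ℝ → ℝ} (hψ : AEStronglyMeasurable ψ)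
    (hψ2 : Integrable fun s => ψ s ^ 2) {K B : ℝ} {F : ℝ → ℝ} (hF : Continuous F)
    (hFB : ∀ ρ, |ρ| ≤ K → |F ρ| ≤ B * ρ ^ 2) (hK : ∀ᵐ x, |ψ x| ≤ K) :
    Integrable fun s => F (ψ s) :=
  (hψ2.const_mul B).mono' (hF.comp_aestronglyMeasurable hψ) (hK.mono fun _ hx => hFB _ hx)

theorem abs_G_le {lam : ℝ} (hlam : 0 < lam) {K : ℝ} (ρ : ℝ) (hK : |ρ| ≤ K) :
    |G lam ρ| ≤ (1 + (1 + lam) * K) * ρ ^ 2 := by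
  rw [abs_of_nonneg (G_nonneg _ _)]
  exact G_le hlam hK

theorem integrable_G_of_mem_H1 {lam : ℝ} (hlam : 0 < lam) {ψ : L2} (h : ψ ∈ H1) :
    Integrable fun s => G lam (ψ s) :=
  integrable_comp_of_ae_abs_le (Lp.aestronglyMeasurable ψ) ψ.integrable_sq (continuous_G lam)
    (abs_G_le hlam) ((isWeakDeriv_weakDeriv h).ae_abs_le one_pos)

/-- The kinetic and potential energies control the energy from below on `Σ₁`. -/
theorem exists_le_energy (C : ℝ) {lam : ℝ} (hlam : 0 < lam) :
    ∃ b : ℝ, ∀ ψ ∈ Sigma1, (∫ s, weakDeriv ψ s ^ 2) / 2 + (∫ s, s ^ 2 * ψ s ^ 2) - b ≤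
      energy C lam ψ := by
  -- The inverse of this number serves as `ε`: the kinetic energy then enters the nonlinear bound
  -- with coefficient `|C| / (2 (|C| + 1)) ≤ 1/2`.
  have hk : 0 < (|C| + 1) * (1 + lam) := by positivity
  refine ⟨|C| * (1 + (1 + lam) * (1 + ((|C| + 1) * (1 + lam)) / 2)), fun ψ hψ => ?_⟩
  set D := ∫ s, weakDeriv ψ s ^ 2 with hD
  have hD0 : 0 ≤ D := integral_nonneg fun s => sq_nonneg _
  have hb := (isWeakDeriv_weakDeriv hψ.1.1).ae_abs_le (inv_pos.2 hk)
  rw [hψ.2, Real.sqrt_one, ← hD, inv_inv] at hb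
  set K := 1 + ((|C| + 1) * (1 + lam) + ((|C| + 1) * (1 + lam))⁻¹ * D) / 2 with hKdef
  have hG : ∫ s, G lam (ψ s) ≤ 1 + (1 + lam) * K := by
    calc ∫ s, G lam (ψ s) ≤ ∫ s, (1 + (1 + lam) * K) * ψ s ^ 2 :=
          integral_mono_ae (integrable_G_of_mem_H1 hlam hψ.1.1) (ψ.integrable_sq.const_mul _)
            (hb.mono fun x hx => G_le hlam hx)
      _ = _ := by
          rw [integral_const_mul]
          change _ * charge ψ = _
          rw [hψ.2, mul_one]
  have hG0 : 0 ≤ ∫ s, G lam (ψ s) := integral_nonneg fun s => G_nonneg _ _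
  have h1 : -(|C| * ∫ s, G lam (ψ s)) ≤ C * ∫ s, G lam (ψ s) := by
    rw [← neg_mul]
    exact mul_le_mul_of_nonneg_right (neg_abs_le C) hG0
  have h2 : |C| * ∫ s, G lam (ψ s) ≤ |C| * (1 + (1 + lam) * K) :=
    mul_le_mul_of_nonneg_left hG (abs_nonneg C)
  have h3 : |C| * (1 + (1 + lam) * K) =
      |C| * (1 + (1 + lam) * (1 + ((|C| + 1) * (1 + lam)) / 2)) + |C| / (|C| + 1) * D / 2 := by
    rw [hKdef]
    field_simp
    ring
  have h4 : |C| / (|C| + 1) * D ≤ D := by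
    refine mul_le_of_le_one_left hD0 ((div_le_one (by positivity)).2 (by linarith))
  unfold energy
  linarith

/-! ### Passage to the limit and compactness. -/

theorem integrable_and_integral_le_of_tendsto {f : ℕ → ℝ → ℝ} {F : ℝ → ℝ} {c : ℝ}
    (hf : ∀ n, Integrable (f n)) (h0 : ∀ n x, 0 ≤ f n x)
    (hF : ∀ᵐ x, Tendsto (fun n => f n x) atTop (𝓝 (F x)))
    (hc : Tendsto (fun n => ∫ x, f n x) atTop (𝓝 c)) :
    Integrable F ∧ ∫ x, F x ≤ c := by
  have hlim : Tendsto (fun n => ∫⁻ x, ‖f n x‖ₑ) atTop (𝓝 (ENNReal.ofReal c)) := by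
    refine (ENNReal.tendsto_ofReal hc).congr fun n => ?_
    rw [ofReal_integral_eq_lintegral_ofReal (hf n) (.of_forall (h0 n))]
    exact lintegral_congr fun x => (Real.enorm_of_nonneg (h0 n x)).symm
  have hF0 : ∀ᵐ x, 0 ≤ F x := hF.mono fun x hx => ge_of_tendsto' hx fun n => h0 n x
  have hFi : Integrable F := integrable_of_tendsto hF (fun n => (hf n).1) (by
    rw [hlim.liminf_eq]; exact ENNReal.ofReal_ne_top)
  refine ⟨hFi, ?_⟩
  have h := lintegral_enorm_le_liminf_of_tendsto hF fun n => (hf n).1.aemeasurable.enorm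
  rw [hlim.liminf_eq, lintegral_congr_ae (hF0.mono fun x hx => Real.enorm_of_nonneg hx),
    ← ofReal_integral_eq_lintegral_ofReal hFi hF0] at h
  exact (ENNReal.ofReal_le_ofReal_iff
    (ge_of_tendsto' hc fun n => integral_nonneg (h0 n))).1 h

/-- Convergence of integrals of superposition operators under confinement by the weight `s²`. -/
theorem tendsto_integral_comp_of_weight {f : ℕ → ℝ → ℝ} {u F : ℝ → ℝ} {K B M : ℝ}
    (hF : Continuous F) (hB : 0 ≤ B) (hFB : ∀ ρ, |ρ| ≤ K → |F ρ| ≤ B * ρ ^ 2)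
    (hfm : ∀ n, AEStronglyMeasurable (f n)) (hum : AEStronglyMeasurable u)
    (hf2 : ∀ n, Integrable fun s => f n s ^ 2) (hu2 : Integrable fun s => u s ^ 2)
    (hfw : ∀ n, Integrable fun s => s ^ 2 * f n s ^ 2) (huw : Integrable fun s => s ^ 2 * u s ^ 2)
    (hfM : ∀ n, ∫ s, s ^ 2 * f n s ^ 2 ≤ M) (huM : ∫ s, s ^ 2 * u s ^ 2 ≤ M)
    (hfK : ∀ n, ∀ᵐ s, |f n s| ≤ K) (hlim : ∀ᵐ s, Tendsto (fun n => f n s) atTop (𝓝 (u s))) :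
    Tendsto (fun n => ∫ s, F (f n s)) atTop (𝓝 (∫ s, F (u s))) := by
  have hfK' : ∀ᵐ s, ∀ n, |f n s| ≤ K := ae_all_iff.2 hfK
  have huK : ∀ᵐ s, |u s| ≤ K := by
    filter_upwards [hfK', hlim] with s h1 h2
    exact le_of_tendsto' h2.abs h1
  have hFf : ∀ n, Integrable fun s => F (f n s) := fun n =>
    integrable_comp_of_ae_abs_le (hfm n) (hf2 n) hF hFB (hfK n)
  have hFu : Integrable fun s => F (u s) := integrable_comp_of_ae_abs_le hum hu2 hF hFB huK
  have hdi : ∀ n, Integrable fun s => |F (f n s) - F (u s)| := fun n => ((hFf n).sub hFu).abs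
  rw [tendsto_iff_norm_sub_tendsto_zero]
  suffices h : Tendsto (fun n => ∫ s, |F (f n s) - F (u s)|) atTop (𝓝 0) by
    refine squeeze_zero (fun n => norm_nonneg _) (fun n => ?_) h
    rw [← integral_sub (hFf n) hFu]
    exact abs_integral_le_integral_abs
  have hM : 0 ≤ M := le_trans (integral_nonneg fun s => by positivity) huM
  -- Off `[-R, R]` one has `1 ≤ s² / R²`, so the tail is small uniformly in `n`; dominated
  -- convergence handles the rest.
  have hsplit : ∀ R > 0, ∀ n, ∫ s, |F (f n s) - F (u s)| ≤
      (∫ s in Icc (-R) R, |F (f n s) - F (u s)|) + 2 * B * M / R ^ 2 := fun R hR n => by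
    have hw : Integrable fun s => B / R ^ 2 * (s ^ 2 * f n s ^ 2 + s ^ 2 * u s ^ 2) :=
      ((hfw n).add huw).const_mul _
    have hi : Integrable ((Icc (-R) R).indicator fun s => |F (f n s) - F (u s)|) :=
      (hdi n).indicator measurableSet_Icc
    calc ∫ s, |F (f n s) - F (u s)|
        ≤ ∫ s, ((Icc (-R) R).indicator (fun s => |F (f n s) - F (u s)|) s +
            B / R ^ 2 * (s ^ 2 * f n s ^ 2 + s ^ 2 * u s ^ 2)) := by
          refine integral_mono_ae (hdi n) (hi.add hw) ?_
          filter_upwards [hfK', huK] with s h1 h2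
          by_cases hs : s ∈ Icc (-R) R
          · rw [indicator_of_mem hs]
            exact le_add_of_nonneg_right (by positivity)
          · rw [indicator_of_notMem hs, zero_add]
            have hsR : R ^ 2 ≤ s ^ 2 := by
              rw [mem_Icc, ← abs_le, not_le] at hs
              rw [← sq_abs s]
              gcongr
            calc |F (f n s) - F (u s)| ≤ |F (f n s)| + |F (u s)| := abs_sub _ _
              _ ≤ B * f n s ^ 2 + B * u s ^ 2 := add_le_add (hFB _ (h1 n)) (hFB _ h2)
              _ = B / R ^ 2 * (R ^ 2 * f n s ^ 2 + R ^ 2 * u s ^ 2) := by field_simp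
              _ ≤ _ := by gcongr
      _ = (∫ s in Icc (-R) R, |F (f n s) - F (u s)|) +
            B / R ^ 2 * ((∫ s, s ^ 2 * f n s ^ 2) + ∫ s, s ^ 2 * u s ^ 2) := by
          rw [integral_add hi hw, integral_indicator measurableSet_Icc, integral_const_mul,
            integral_add (hfw n) huw]
      _ ≤ (∫ s in Icc (-R) R, |F (f n s) - F (u s)|) + B / R ^ 2 * (M + M) := by
          gcongr
          exact hfM n
      _ = _ := by ring
  have hloc : ∀ R : ℝ, Tendsto (fun n => ∫ s in Icc (-R) R, |F (f n s) - F (u s)|) atTop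
      (𝓝 0) := fun R => by
    have := tendsto_integral_of_dominated_convergence (μ := volume.restrict (Icc (-R) R))
      (F := fun n s => |F (f n s) - F (u s)|) (f := fun _ => 0) (fun _ => B * K ^ 2 + B * K ^ 2)
      (fun n => (hdi n).1.restrict) (integrableOn_const (by simp)) (fun n => ?_) ?_
    · simpa using this
    · refine ae_restrict_of_ae ?_
      filter_upwards [hfK', huK] with s h1 h2
      rw [Real.norm_eq_abs, abs_abs]
      have e1 : f n s ^ 2 ≤ K ^ 2 := sq_le_sq' (abs_le.1 (h1 n)).1 (abs_le.1 (h1 n)).2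
      have e2 : u s ^ 2 ≤ K ^ 2 := sq_le_sq' (abs_le.1 h2).1 (abs_le.1 h2).2
      calc |F (f n s) - F (u s)| ≤ |F (f n s)| + |F (u s)| := abs_sub _ _
        _ ≤ B * f n s ^ 2 + B * u s ^ 2 := add_le_add (hFB _ (h1 n)) (hFB _ h2)
        _ ≤ _ := by gcongr
    · refine ae_restrict_of_ae ?_
      filter_upwards [hlim] with s hs
      have := (((hF.tendsto _).comp hs).sub_const (F (u s))).abs
      simpa using this
  refine tendsto_order.2 ⟨fun a ha => .of_forall fun n =>
    ha.trans_le (integral_nonneg fun s => abs_nonneg _), fun δ hδ => ?_⟩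
  have hR : Tendsto (fun R : ℝ => 2 * B * M / R ^ 2) atTop (𝓝 0) :=
    tendsto_const_nhds.div_atTop (tendsto_pow_atTop two_ne_zero)
  obtain ⟨R, hRδ, hR0⟩ := ((hR.eventually_lt_const (half_pos hδ)).and (eventually_gt_atTop 0)).exists
  filter_upwards [(hloc R).eventually_lt_const (half_pos hδ)] with n hn
  linarith [hsplit R hR0 n]

/-- Bounded sequences in `L²(ℝ)` have weakly convergent subsequences. -/
theorem L2.exists_subseq_tendsto_inner (g : ℕ → L2) {M : ℝ} (hM : ∀ n, ‖g n‖ ≤ M) :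
    ∃ (g' : L2) (σ : ℕ → ℕ), StrictMono σ ∧
      ∀ f : L2, Tendsto (fun n => inner ℝ (g (σ n)) f) atTop (𝓝 (inner ℝ g' f)) := by
  have : Fact ((2 : ENNReal) ≠ ⊤) := ⟨ENNReal.ofNat_ne_top⟩
  -- Separability makes Banach–Alaoglu sequential; the Riesz isometry carries it back to `L2`.
  have : SecondCountableTopology L2 := Lp.SecondCountableTopology
  let T := InnerProductSpace.toDual ℝ L2
  obtain ⟨w, -, σ, hσ, hw⟩ := WeakDual.isSeqCompact_closedBall ℝ L2 0 M
    (x := fun n => StrongDual.toWeakDual (T (g n))) fun n => by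
      rw [mem_preimage, mem_closedBall_zero_iff]
      exact (T.norm_map (g n)).trans_le (hM n)
  refine ⟨T.symm (WeakDual.toStrongDual w), σ, hσ, fun f => ?_⟩
  have h := ((WeakDual.eval_continuous f).tendsto w).comp hw
  have e : inner ℝ (T.symm (WeakDual.toStrongDual w)) f = w f :=
    InnerProductSpace.toDual_symm_apply
  rw [e]
  exact h

/-- Weak lower semicontinuity: pass to the limit in `⟪g n, g'⟫ ≤ (‖g n‖² + ‖g'‖²) / 2`. -/
theorem L2.norm_sq_le_of_tendsto_inner {g : ℕ → L2} {g' : L2} {d : ℝ}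
    (hg : Tendsto (fun n => inner ℝ (g n) g') atTop (𝓝 (inner ℝ g' g')))
    (hd : Tendsto (fun n => ‖g n‖ ^ 2) atTop (𝓝 d)) : ‖g'‖ ^ 2 ≤ d := by
  have h : ‖g'‖ ^ 2 ≤ (d + ‖g'‖ ^ 2) / 2 := by
    rw [real_inner_self_eq_norm_sq] at hg
    refine le_of_tendsto_of_tendsto' hg ((hd.add_const _).div_const 2) fun n => ?_
    have h1 := real_inner_le_norm (g n) g'
    nlinarith [sq_nonneg (‖g n‖ - ‖g'‖)]
  linarith

theorem tendsto_setIntegral_of_tendsto_inner {g : ℕ → L2} {g' : L2}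
    (hg : ∀ f : L2, Tendsto (fun n => inner ℝ (g n) f) atTop (𝓝 (inner ℝ g' f)))
    {s : Set ℝ} (hs : MeasurableSet s) (hv : volume s ≠ ⊤) :
    Tendsto (fun n => ∫ t in s, g n t) atTop (𝓝 (∫ t in s, g' t)) := by
  have h := hg (indicatorConstLp 2 hs hv (1 : ℝ))
  simp_rw [real_inner_comm (indicatorConstLp 2 hs hv (1 : ℝ)), L2.inner_indicatorConstLp_one] at h
  exact h

/-- Testing weak convergence against indicators of bounded intervals upgrades it to pointwise
convergence of primitives. -/
theorem tendsto_primitive_of_tendsto_inner {g : ℕ → L2} {g' : L2}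
    (hg : ∀ f : L2, Tendsto (fun n => inner ℝ (g n) f) atTop (𝓝 (inner ℝ g' f))) (x : ℝ) :
    Tendsto (fun n => ∫ t in (0 : ℝ)..x, g n t) atTop (𝓝 (∫ t in (0 : ℝ)..x, g' t)) := by
  simp_rw [intervalIntegral]
  exact (tendsto_setIntegral_of_tendsto_inner hg measurableSet_Ioc (by simp)).sub
    (tendsto_setIntegral_of_tendsto_inner hg measurableSet_Ioc (by simp))

theorem L2.inner_toLp {φ : ℝ → ℝ} (hφ : MemLp φ 2) (f : L2) :
    inner ℝ f (hφ.toLp φ) = ∫ s, f s * φ s := by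
  rw [L2.inner_def]
  refine integral_congr_ae (hφ.coeFn_toLp.mono fun s hs => ?_)
  simp [hs, mul_comm]

/-- Weak derivatives pass to the limit. -/
theorem IsWeakDeriv.of_tendsto {ψ g : ℕ → L2} {ψ' g' : L2} (h : ∀ n, IsWeakDeriv (ψ n) (g n))
    (hg : ∀ f : L2, Tendsto (fun n => inner ℝ (g n) f) atTop (𝓝 (inner ℝ g' f)))
    {K : ℝ} (hK : ∀ n, ∀ᵐ s, |ψ n s| ≤ K)
    (hψ : ∀ᵐ s, Tendsto (fun n => ψ n s) atTop (𝓝 (ψ' s))) : IsWeakDeriv ψ' g' := by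
  intro φ hφ hc
  have hd : Continuous (deriv φ) := hφ.continuous_deriv (by simp)
  have hφ2 : MemLp φ 2 := hφ.continuous.memLp_of_hasCompactSupport hc
  have h1 := (hg (hφ2.toLp φ)).neg
  simp_rw [L2.inner_toLp, ← h _ φ hφ hc] at h1
  refine tendsto_nhds_unique (tendsto_integral_of_dominated_convergence
    (fun s => K * |deriv φ s|)
    (fun n => (Lp.aestronglyMeasurable (ψ n)).mul hd.aestronglyMeasurable)
    ((hd.integrable_of_hasCompactSupport hc.deriv).abs.const_mul K) (fun n => ?_) ?_) h1
  · filter_upwards [hK n] with s hs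
    rw [Pi.mul_apply, norm_mul, Real.norm_eq_abs, Real.norm_eq_abs]
    gcongr
  · exact hψ.mono fun s hs => hs.mul_const _

/-- Compactness of bounded sequences in `Σ₁`, with lower semicontinuity of the quadratic terms and
continuity of the nonlinear term. -/
theorem exists_limit_of_bounded {lam : ℝ} (hlam : 0 < lam) {ψ : ℕ → L2} (hψ : ∀ n, ψ n ∈ Sigma1)
    {d v : ℝ} (hd : Tendsto (fun n => ∫ s, weakDeriv (ψ n) s ^ 2) atTop (𝓝 d))
    (hv : Tendsto (fun n => ∫ s, s ^ 2 * ψ n s ^ 2) atTop (𝓝 v)) :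
    ∃ ψ' ∈ Sigma1, ∃ σ : ℕ → ℕ, StrictMono σ ∧ ∫ s, weakDeriv ψ' s ^ 2 ≤ d ∧
      ∫ s, s ^ 2 * ψ' s ^ 2 ≤ v ∧
      Tendsto (fun n => ∫ s, G lam (ψ (σ n) s)) atTop (𝓝 (∫ s, G lam (ψ' s))) := by
  obtain ⟨M₁, hM₁⟩ := hd.bddAbove_range
  obtain ⟨M₂, hM₂⟩ := hv.bddAbove_range
  replace hM₁ : ∀ n, ∫ s, weakDeriv (ψ n) s ^ 2 ≤ M₁ := fun n => hM₁ (mem_range_self n)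
  replace hM₂ : ∀ n, ∫ s, s ^ 2 * ψ n s ^ 2 ≤ M₂ := fun n => hM₂ (mem_range_self n)
  have hD : ∀ n, IsWeakDeriv (ψ n) (weakDeriv (ψ n)) := fun n =>
    isWeakDeriv_weakDeriv (hψ n).1.1
  choose a ha using fun n => (hD n).exists_ae_eq_primitive
  set K : ℝ := 1 + (1 + M₁) / 2 with hKdef
  have hK : ∀ n x, |a n + ∫ t in (0 : ℝ)..x, weakDeriv (ψ n) t| ≤ K := fun n x => by
    have := abs_add_primitive_le (ha n) one_pos x
    rw [(hψ n).2, Real.sqrt_one, inv_one, one_mul] at this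
    linarith [hM₁ n]
  obtain ⟨g, σ₁, hσ₁, hg⟩ := L2.exists_subseq_tendsto_inner (fun n => weakDeriv (ψ n))
    (M := √M₁) fun n => Real.le_sqrt_of_sq_le ((L2.norm_sq_eq _).trans_le (hM₁ n))
  -- The integration constants are the values at `0`, hence bounded by `K`.
  obtain ⟨a', -, σ₂, hσ₂, ha'⟩ := tendsto_subseq_of_bounded (Metric.isBounded_closedBall (x := 0)
    (r := K)) (x := a ∘ σ₁) fun n => by
      simpa using hK (σ₁ n) 0
  set σ := σ₁ ∘ σ₂ with hσdef
  have hσ : StrictMono σ := hσ₁.comp hσ₂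
  have hg' : ∀ f : L2, Tendsto (fun n => inner ℝ (weakDeriv (ψ (σ n))) f) atTop
      (𝓝 (inner ℝ g f)) := fun f => (hg f).comp hσ₂.tendsto_atTop
  set u : ℝ → ℝ := fun x => a' + ∫ t in (0 : ℝ)..x, g t with hu
  have hconv : ∀ᵐ x, Tendsto (fun n => ψ (σ n) x) atTop (𝓝 (u x)) := by
    filter_upwards [ae_all_iff.2 ha] with x hx
    simp_rw [hx]
    exact ha'.add (tendsto_primitive_of_tendsto_inner hg' x)
  have hψK : ∀ n, ∀ᵐ x, |ψ (σ n) x| ≤ K := fun n => (ha (σ n)).mono fun x hx => by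
    rw [hx]; exact hK _ x
  have hQ : ∀ n, ∫ s, ψ (σ n) s ^ 2 = 1 := fun n => (hψ (σ n)).2
  have hum : AEStronglyMeasurable u :=
    (continuous_const.add g.continuous_primitive).aestronglyMeasurable
  have hu2 : Integrable fun s => u s ^ 2 :=
    (integrable_and_integral_le_of_tendsto (fun n => (ψ (σ n)).integrable_sq)
      (fun n x => sq_nonneg _) (hconv.mono fun x hx => hx.pow 2)
      (tendsto_const_nhds.congr fun n => (hQ n).symm)).1
  obtain ⟨huw, huv⟩ := integrable_and_integral_le_of_tendsto
    (fun n => integrable_weight_of_mem_X (hψ (σ n)).1) (fun n x => by positivity)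
    (hconv.mono fun x hx => (hx.pow 2).const_mul (x ^ 2)) (hv.comp hσ.tendsto_atTop)
  have hcomp : ∀ {B : ℝ} {F : ℝ → ℝ}, Continuous F → 0 ≤ B →
      (∀ ρ, |ρ| ≤ K → |F ρ| ≤ B * ρ ^ 2) →
      Tendsto (fun n => ∫ s, F (ψ (σ n) s)) atTop (𝓝 (∫ s, F (u s))) := fun hF hB hFB =>
    tendsto_integral_comp_of_weight hF hB hFB (fun n => Lp.aestronglyMeasurable _) hum
      (fun n => (ψ (σ n)).integrable_sq) hu2
      (fun n => integrable_weight_of_mem_X (hψ (σ n)).1) huw (fun n => hM₂ (σ n))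
      (huv.trans (le_of_tendsto' hv hM₂)) hψK hconv
  have huL : MemLp u 2 := (memLp_two_iff_integrable_sq hum).2 hu2
  have hae := huL.coeFn_toLp
  have hW : IsWeakDeriv (huL.toLp u) g := by
    refine IsWeakDeriv.of_tendsto (fun n => hD (σ n)) hg' hψK ?_
    filter_upwards [hconv, hae] with x hx hx'
    rwa [hx']
  have hK0 : 0 ≤ K := (abs_nonneg _).trans (hK 0 0)
  have hw' : (fun s : ℝ => s ^ 2 * huL.toLp u s ^ 2) =ᵐ[volume] fun s => s ^ 2 * u s ^ 2 :=
    hae.mono fun x hx => by simp only [hx]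
  refine ⟨huL.toLp u, ⟨⟨⟨g, hW⟩, ?_⟩, ?_⟩, σ, hσ, ?_, ?_, ?_⟩
  · exact (L2.integrable_sq _).add (huw.congr hw'.symm)
  -- With `F = ρ²` the confinement result says that no charge is lost in the limit.
  · have h1 := hcomp (B := 1) (F := fun ρ => ρ ^ 2) (continuous_pow 2) zero_le_one
      fun ρ _ => by simp
    simp_rw [hQ] at h1
    refine Eq.trans (integral_congr_ae (hae.mono fun x hx => ?_))
      (tendsto_nhds_unique tendsto_const_nhds h1).symm
    simp only [hx]
  · rw [hW.weakDeriv_eq, ← L2.norm_sq_eq]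
    refine L2.norm_sq_le_of_tendsto_inner (hg' g) ?_
    simp_rw [L2.norm_sq_eq]
    exact hd.comp hσ.tendsto_atTop
  · rwa [integral_congr_ae hw']
  · have h1 := hcomp (continuous_G lam) (B := 1 + (1 + lam) * K) (by positivity) (abs_G_le hlam)
    rwa [← integral_congr_ae (f := fun s => G lam (huL.toLp u s))
      (hae.mono fun x hx => by simp only [hx])] at h1

/-! ### Existence of the minimizer. -/

theorem Sigma1_nonempty : Sigma1.Nonempty := by
  let η : ContDiffBump (0 : ℝ) := ⟨1, 2, one_pos, one_lt_two⟩
  have hη2 : Integrable fun s => η s ^ 2 := by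
    simp_rw [pow_two]
    exact (η.continuous.mul η.continuous).integrable_of_hasCompactSupport
      η.hasCompactSupport.mul_left
  have hpos : 0 < ∫ s, η s ^ 2 := by
    refine (integral_pos_iff_support_of_nonneg (fun s => sq_nonneg _) hη2).2 ?_
    rw [show (Function.support fun s => η s ^ 2) = Metric.ball 0 2 by
      rw [Function.support_pow _ two_ne_zero]; exact η.support_eq]
    exact Metric.measure_ball_pos _ _ two_pos
  set f : ℝ → ℝ := fun s => (√(∫ s, η s ^ 2))⁻¹ * η s with hf
  have hfs : ContDiff ℝ ∞ f := contDiff_const.mul η.contDiff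
  have hfc : HasCompactSupport f := η.hasCompactSupport.mul_left
  have hdc : Continuous (deriv f) := hfs.continuous_deriv (by simp)
  have hfL : MemLp f 2 := hfs.continuous.memLp_of_hasCompactSupport hfc
  have hdL : MemLp (deriv f) 2 := hdc.memLp_of_hasCompactSupport hfc.deriv
  have hW : IsWeakDeriv (hfL.toLp f) (hdL.toLp (deriv f)) := fun φ hφ hc => by
    have hφd : Continuous (deriv φ) := hφ.continuous_deriv (by simp)
    rw [integral_congr_ae (g := fun s => f s * deriv φ s)
        (hfL.coeFn_toLp.mono fun x hx => by simp only [hx]),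
      integral_congr_ae (f := fun s => hdL.toLp (deriv f) s * φ s) (g := fun s => deriv f s * φ s)
        (hdL.coeFn_toLp.mono fun x hx => by simp only [hx])]
    exact integral_mul_deriv_eq_deriv_mul_of_integrable
      (fun x _ => (hfs.differentiable (by simp) x).hasDerivAt)
      (fun x _ => (hφ.differentiable (by simp) x).hasDerivAt)
      ((hfs.continuous.mul hφd).integrable_of_hasCompactSupport hfc.mul_right)
      ((hdc.mul hφ.continuous).integrable_of_hasCompactSupport hc.mul_left)
      ((hfs.continuous.mul hφ.continuous).integrable_of_hasCompactSupport hfc.mul_right)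
  refine ⟨hfL.toLp f, ⟨⟨_, hW⟩, (L2.integrable_sq _).add ?_⟩, ?_⟩
  · have : Integrable fun s : ℝ => s ^ 2 * f s ^ 2 := by
      have h2 : (fun s : ℝ => s ^ 2 * f s ^ 2) = fun s => s ^ 2 * f s * f s := by
        ext s; ring
      rw [h2]
      exact (((continuous_pow 2).mul hfs.continuous).mul
        hfs.continuous).integrable_of_hasCompactSupport hfc.mul_left
    exact this.congr (hfL.coeFn_toLp.mono fun x hx => by simp only [hx])
  · unfold charge
    rw [integral_congr_ae (g := fun s => f s ^ 2)
      (hfL.coeFn_toLp.mono fun x hx => by simp only [hx])]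
    simp_rw [hf, mul_pow]
    rw [integral_const_mul, inv_pow, Real.sq_sqrt hpos.le, inv_mul_cancel₀ hpos.ne']

theorem exists_energy_minimizer (C : ℝ) {lam : ℝ} (hlam : 0 < lam) :
    ∃ ψ ∈ Sigma1, ∀ ξ ∈ Sigma1, energy C lam ψ ≤ energy C lam ξ := by
  obtain ⟨b, hb⟩ := exists_le_energy C hlam
  have hD0 : ∀ ξ : L2, 0 ≤ ∫ s, weakDeriv ξ s ^ 2 := fun ξ => integral_nonneg fun s => sq_nonneg _
  have hV0 : ∀ ξ : L2, 0 ≤ ∫ s, s ^ 2 * ξ s ^ 2 := fun ξ => integral_nonneg fun s => by positivity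
  have hbdd : BddBelow (energy C lam '' Sigma1) := by
    refine ⟨-b, ?_⟩
    rintro _ ⟨ξ, hξ, rfl⟩
    linarith [hb ξ hξ, hD0 ξ, hV0 ξ]
  obtain ⟨e, -, he, heS⟩ := exists_seq_tendsto_sInf (Sigma1_nonempty.image (energy C lam)) hbdd
  choose ψ hψ hψe using heS
  obtain ⟨M, hM⟩ := he.bddAbove_range
  replace hM : ∀ n, energy C lam (ψ n) ≤ M := fun n => (hψe n).trans_le (hM (mem_range_self n))
  -- Coercivity confines the kinetic and potential energies to a box, so both converge along a
  -- common subsequence.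
  obtain ⟨p, -, τ, hτ, hp⟩ := tendsto_subseq_of_bounded
    (Metric.isBounded_Icc (0 : ℝ × ℝ) (2 * (M + b), M + b))
    (x := fun n => (∫ s, weakDeriv (ψ n) s ^ 2, ∫ s, s ^ 2 * ψ n s ^ 2)) fun n => by
      have h1 := hb _ (hψ n)
      have h2 := hM n
      have h3 := hD0 (ψ n)
      have h4 := hV0 (ψ n)
      exact ⟨⟨h3, h4⟩, ⟨by dsimp only; linarith, by dsimp only; linarith⟩⟩
  have hd := (continuous_fst.tendsto p).comp hp
  have hv := (continuous_snd.tendsto p).comp hp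
  obtain ⟨ψ', hψ', σ, hσ, hd', hv', hG⟩ :=
    exists_limit_of_bounded hlam (ψ := ψ ∘ τ) (fun n => hψ (τ n)) hd hv
  refine ⟨ψ', hψ', fun ξ hξ => le_trans ?_ (csInf_le hbdd (mem_image_of_mem _ hξ))⟩
  have hlim : Tendsto (fun n => energy C lam (ψ (τ (σ n)))) atTop
      (𝓝 (p.1 + p.2 + C * ∫ s, G lam (ψ' s))) :=
    ((hd.comp hσ.tendsto_atTop).add (hv.comp hσ.tendsto_atTop)).add (hG.const_mul C)
  have hlim' : Tendsto (fun n => energy C lam (ψ (τ (σ n)))) atTop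
      (𝓝 (sInf (energy C lam '' Sigma1))) := by
    simp_rw [hψe]
    exact he.comp (hτ.comp hσ).tendsto_atTop
  -- The infimum is `p.1 + p.2` plus the exact nonlinear term of `ψ'`; only the two quadratic terms
  -- remain to be compared.
  rw [← tendsto_nhds_unique hlim hlim']
  unfold energy
  gcongr

end GroundState

theorem theorem2p4 (C lam : ℝ) (hlam : 0 < lam) :
    (∀ ψ ∈ GroundState.X,
      Integrable (fun s : ℝ => GroundState.weakDeriv ψ s ^ 2) ∧
      Integrable (fun s : ℝ => s ^ 2 * ψ s ^ 2) ∧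
      Integrable (fun s : ℝ => GroundState.G lam (ψ s))) ∧
    ∃ φmin ∈ GroundState.Sigma1,
      IsLeast (GroundState.energy C lam '' GroundState.Sigma1)
        (GroundState.energy C lam φmin) := by
  refine ⟨fun ψ hψ => ⟨GroundState.L2.integrable_sq _, GroundState.integrable_weight_of_mem_X hψ,
    GroundState.integrable_G_of_mem_H1 hlam hψ.1⟩, ?_⟩
  obtain ⟨ψ, hψ, hmin⟩ := GroundState.exists_energy_minimizer C hlam
  refine ⟨ψ, hψ, Set.mem_image_of_mem _ hψ, ?_⟩
  rintro _ ⟨ξ, hξ, rfl⟩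
  exact hmin ξ hξ
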